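/- For $b,\mu>0$ and an integer $j\ge 2$ put $$I^-_{1,j,1}(b,\mu)=\int_0^\infty \frac{x}{(x^2+b^2)^j\,(e^{\mu x}-1)}\,dx,\qquad \hat I^-_{1,j,1}(b)=I^-_{1,j,1}(b,1).$$ These integrals converge absolutely. Let $\psi=\Gamma'/\Gamma$ be the digamma function and $\psi^{(i)}$ its $i$-th derivative. For a real array $\gamma^-=(\gamma^-_{j,i})_{j\ge 2,\,-1\le i\le j-1}$ the following are equivalent. (a) (The $\gamma^-_{j,i}$ are expansion coefficients.) For all $j\ge 2$ and all $b,\mu>0$, $$\hat I^-_{1,j,1}(b\mu)=-\gamma^-_{j,-1}\frac{\pi}{(b\mu)^{2j-1}}-\gamma^-_{j,0}\frac{1}{(b\mu)^{2j-2}}-\sum_{i=1}^{j-1}(-1)^i\gamma^-_{j,i}\frac{1}{(b\mu)^{2j-i-2}\pi^i}\,\psi^{(i)}\!\left(\frac{b\mu}{2\pi}\right).$$ (b) (Recursion.) $\gamma^-_{2,-1}=\gamma^-_{2,0}=\tfrac14$, $\gamma^-_{2,1}=\tfrac18$, and for all $j>2$ $$\gamma^-_{j,i}=\begin{cases} \frac{2j-3}{2j-2}\gamma^-_{j-1,i},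 & i=-1;\\ \frac{j-2}{j-1}\gamma^-_{j-1,i}, & i=0;\\ \frac{2j-i-4}{2j-2}\gamma^-_{j-1,i}, & i=1;\\ \frac{2j-i-4}{2j-2}\gamma^-_{j-1,i}+\frac{1}{4(j-1)}\gamma^-_{j-1,i-1}, & 2\le i<j-1;\\ \frac{1}{4(j-1)}\gamma^-_{j-1,i-1}, & i=j-1. \end{cases}$$ Such an array exists (it is constructed by (b), and is therefore unique), and with it $I^-_{1,j,1}(b,\mu)$ equals $\mu^{2j-2}$ times the right-hand side of (a), for all $j\ge 2$ and $b,\mu>0$. -/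

import Mathlib

open MeasureTheory Set

/-- The polygamma function `ψ^{(n)}` at a real argument: the `n`-th derivative of the digamma
function `ψ = Γ'/Γ`. It takes real values on the real axis, see `ofReal_realPolygamma`. -/
noncomputable def realPolygamma (n : ℕ) (x : ℝ) : ℝ :=
  (iteratedDeriv n Complex.digamma (x : ℂ)).re

/-- Taking the real part in `realPolygamma` loses nothing. -/
theorem ofReal_realPolygamma (n : ℕ) (x : ℝ) :
    (realPolygamma n x : ℂ) = iteratedDeriv n Complex.digamma (x : ℂ) := by
  have key : ∀ (n : ℕ) (z : ℂ), iteratedDeriv n Complex.digamma ((starRingEnd ℂ) z)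
      = (starRingEnd ℂ) (iteratedDeriv n Complex.digamma z) := by
    intro n
    induction n with
    | zero =>
      intro z
      have hG : (starRingEnd ℂ) ∘ Complex.Gamma ∘ (starRingEnd ℂ) = Complex.Gamma := by
        ext w
        simp [Complex.Gamma_conj]
      have h := congrFun (deriv_conj_conj (f := Complex.Gamma)) z
      rw [hG, Function.comp_apply, Function.comp_apply] at h
      simp only [iteratedDeriv_zero, Complex.digamma_def, logDeriv_apply, map_div₀,
        Complex.Gamma_conj, h, Complex.conj_conj]
    | succ k ih =>
      intro z
      have hG : (starRingEnd ℂ) ∘ iteratedDeriv k Complex.digamma ∘ (starRingEnd ℂ)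
          = iteratedDeriv k Complex.digamma := by
        ext w
        simp [ih]
      have h := congrFun (deriv_conj_conj (f := iteratedDeriv k Complex.digamma)) z
      rw [hG, Function.comp_apply, Function.comp_apply] at h
      rw [iteratedDeriv_succ, h, Complex.conj_conj]
  have h := key n (x : ℂ)
  rw [Complex.conj_ofReal] at h
  exact Complex.conj_eq_iff_re.mp h.symm

/-- The integrand `x ^ n / ((x ^ 2 + b ^ 2) ^ j (e ^ {μ x} - 1) ^ s)`. -/
noncomputable def integrandMinus (n j s : ℕ) (b μ x : ℝ) : ℝ :=
  x ^ n / ((x ^ 2 + b ^ 2) ^ j * (Real.exp (μ * x) - 1) ^ s)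

/-- The integral `I⁻_{n,j,s}(b, μ)`. -/
noncomputable def integralMinus (n j s : ℕ) (b μ : ℝ) : ℝ :=
  ∫ x in Ioi (0 : ℝ), integrandMinus n j s b μ x

/-- The normalized integral `Î⁻_{n,j,s}(b) = I⁻_{n,j,s}(b, 1)`. -/
noncomputable def normIntegralMinus (n j s : ℕ) (b : ℝ) : ℝ :=
  integralMinus n j s b 1

/-- The linear combination of `π / c ^ (2j-1)`, `1 / c ^ (2j-2)` and
`ψ^{(i)}(c / 2π) / (c ^ (2j-i-2) π ^ i)`, `1 ≤ i ≤ j - 1`, with coefficients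
`-g (-1)`, `-g 0` and `-(-1) ^ i g i`. For `j ≥ 2` no subtraction of exponents truncates. -/
noncomputable def polygammaExpansion (j : ℕ) (g : ℤ → ℝ) (c : ℝ) : ℝ :=
  - g (-1) * (Real.pi / c ^ (2 * j - 1))
  - g 0 * (1 / c ^ (2 * j - 2))
  - ∑ i ∈ Finset.Icc 1 (j - 1),
      (-1) ^ i * g i * (1 / (c ^ (2 * j - i - 2) * Real.pi ^ i)) *
        realPolygamma i (c / (2 * Real.pi))

/-- The starting values and the five-case recursion for the array `γ j i`, `j ≥ 2`,
`-1 ≤ i ≤ j - 1`. -/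
structure GammaMinusRecursion (γ : ℕ → ℤ → ℝ) : Prop where
  start_neg_one : γ 2 (-1) = 1 / 4
  start_zero : γ 2 0 = 1 / 4
  start_one : γ 2 1 = 1 / 8
  step_neg_one : ∀ j : ℕ, 2 < j →
    γ j (-1) = (2 * (j : ℝ) - 3) / (2 * (j : ℝ) - 2) * γ (j - 1) (-1)
  step_zero : ∀ j : ℕ, 2 < j →
    γ j 0 = ((j : ℝ) - 2) / ((j : ℝ) - 1) * γ (j - 1) 0
  step_one : ∀ j : ℕ, 2 < j →
    γ j 1 = (2 * (j : ℝ) - 1 - 4) / (2 * (j : ℝ) - 2) * γ (j - 1) 1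
  step_mid : ∀ (j : ℕ) (i : ℤ), 2 < j → 2 ≤ i → i < (j : ℤ) - 1 →
    γ j i = (2 * (j : ℝ) - (i : ℝ) - 4) / (2 * (j : ℝ) - 2) * γ (j - 1) i
      + 1 / (4 * ((j : ℝ) - 1)) * γ (j - 1) (i - 1)
  step_last : ∀ (j : ℕ) (i : ℤ), 2 < j → i = (j : ℤ) - 1 →
    γ j i = 1 / (4 * ((j : ℝ) - 1)) * γ (j - 1) (i - 1)

open Filter Topology

/-! Write `c = bμ` and `Î_j` for the normalized integral. Differentiation under the integral sign
gives `Î_j' (c) = -2 j c Î_{j+1}(c)`. If the coefficients obey the recursion, the polygamma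
expansions satisfy the same relation (`GammaMinusRecursion.hasDerivAt_polygammaExpansion`), so the
expansion for one `j` yields the next. The start `j = 2` is `normIntegralMinus_two`: the partial
fraction series of `1 / (e^x - 1)`, integrated termwise, becomes the series `∑ (y + k)⁻²` of
`ψ'(y)`, `y = c / 2π`. The substitution `x ↦ μx` then gives general `μ`.

Conversely, the functions in the expansion are linearly independent (`eq_zero_of_digamma_relation`).
A relation on the half-line continues analytically to the complement of the poles of `Γ`, and at
`-1` the derivatives of `ψ` have poles of distinct orders. The point `0` would not do, since the
factor `x ^ (i + 2)` cancels the pole of `ψ^{(i + 1)}` there. So any expansion coefficients coincide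
with a recursively built array on the relevant indices. -/

/-! ### Analyticity of the digamma function off the poles of Γ -/

theorem Complex.ne_neg_nat_of_re_pos {s : ℂ} (hs : 0 < s.re) (m : ℕ) : s ≠ -m := by
  rintro rfl
  have : (0 : ℝ) ≤ m := m.cast_nonneg
  simp at hs
  linarith

/-- The complement of the set of poles of the Gamma function. -/
def gammaDomain : Set ℂ := (range fun m : ℕ => (-m : ℂ))ᶜ

theorem mem_gammaDomain {s : ℂ} : s ∈ gammaDomain ↔ ∀ m : ℕ, s ≠ -m := by
  simp [gammaDomain, eq_comm]

theorem isOpen_gammaDomain : IsOpen gammaDomain := by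
  have h : IsClosed ((fun m : ℤ => (m : ℂ)) '' {m | m ≤ 0}) :=
    Complex.isClosedEmbedding_intCast.isClosedMap _ (isClosed_discrete _)
  rw [gammaDomain, isOpen_compl_iff]
  convert! h using 1
  ext z
  constructor
  · rintro ⟨m, rfl⟩
    exact ⟨-m, by simp, by simp⟩
  · rintro ⟨m, hm, rfl⟩
    obtain ⟨k, rfl⟩ := Int.exists_eq_neg_ofNat hm
    exact ⟨k, by simp⟩

/-- Removing a countable set from the plane, of real dimension two, leaves it connected. -/
theorem isPreconnected_gammaDomain : IsPreconnected gammaDomain :=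
  ((countable_range _).isConnected_compl_of_one_lt_rank (by simp)).isPreconnected

theorem ofReal_mem_gammaDomain {x : ℝ} (hx : 0 < x) : (x : ℂ) ∈ gammaDomain :=
  mem_gammaDomain.2 fun m => Complex.ne_neg_nat_of_re_pos (by simpa using hx) m

theorem analyticOnNhd_Gamma : AnalyticOnNhd ℂ Complex.Gamma gammaDomain :=
  DifferentiableOn.analyticOnNhd
    (fun s hs => (Complex.differentiableAt_Gamma s (mem_gammaDomain.1 hs)).differentiableWithinAt)
    isOpen_gammaDomain

theorem analyticOnNhd_digamma : AnalyticOnNhd ℂ Complex.digamma gammaDomain := fun s hs => by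
  rw [Complex.digamma_def]
  exact (analyticOnNhd_Gamma s hs).deriv.div (analyticOnNhd_Gamma s hs)
    (Complex.Gamma_ne_zero (mem_gammaDomain.1 hs))

theorem analyticOnNhd_iteratedDeriv_digamma (n : ℕ) :
    AnalyticOnNhd ℂ (iteratedDeriv n Complex.digamma) gammaDomain := by
  rw [iteratedDeriv_eq_iterate]
  exact fun s hs => (analyticOnNhd_digamma s hs).iterated_deriv n

/-! ### Real polygamma functions and the series of ψ' -/

theorem hasDerivAt_realPolygamma (n : ℕ) {x : ℝ} (hx : 0 < x) :
    HasDerivAt (realPolygamma n) (realPolygamma (n + 1) x) x := by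
  have h := (analyticOnNhd_iteratedDeriv_digamma n _
    (ofReal_mem_gammaDomain hx)).differentiableAt.hasDerivAt
  rw [← iteratedDeriv_succ] at h
  exact h.real_of_complex

theorem realPolygamma_zero_add_one {x : ℝ} (hx : 0 < x) :
    realPolygamma 0 (x + 1) = realPolygamma 0 x + x⁻¹ := by
  have h := Complex.digamma_apply_add_one x (mem_gammaDomain.1 (ofReal_mem_gammaDomain hx))
  have h' := congrArg Complex.re h
  simpa [realPolygamma, ← Complex.ofReal_inv] using h'

theorem realPolygamma_zero_add_nat {x : ℝ} (hx : 0 < x) (n : ℕ) :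
    realPolygamma 0 (x + n) = realPolygamma 0 x + ∑ k ∈ Finset.range n, (x + k)⁻¹ := by
  induction n with
  | zero => simp
  | succ n ih =>
    rw [Finset.sum_range_succ, ← add_assoc, ← ih, ← realPolygamma_zero_add_one (by positivity)]
    push_cast
    ring_nf

theorem hasDerivAt_log_Gamma {x : ℝ} (hx : 0 < x) :
    HasDerivAt (Real.log ∘ Real.Gamma) (realPolygamma 0 x) x := by
  have h : HasDerivAt Real.Gamma (deriv Complex.Gamma x).re x :=
    (Complex.differentiableAt_Gamma x
      (mem_gammaDomain.1 (ofReal_mem_gammaDomain hx))).hasDerivAt.real_of_complex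
  convert! h.log (Real.Gamma_pos_of_pos hx).ne' using 1
  rw [realPolygamma, iteratedDeriv_zero, Complex.digamma_def, logDeriv_apply,
    Complex.Gamma_ofReal, Complex.div_ofReal_re]

/-- Log-convexity of `Γ`, since `ψ` is the derivative of `log Γ`. -/
theorem monotoneOn_realPolygamma_zero : MonotoneOn (realPolygamma 0) (Ioi 0) := by
  intro x hx y hy hxy
  have h := Real.convexOn_log_Gamma.monotoneOn_deriv
    (fun z hz => (hasDerivAt_log_Gamma hz).differentiableAt) hx hy hxy
  rwa [(hasDerivAt_log_Gamma hx).deriv, (hasDerivAt_log_Gamma hy).deriv] at h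

/-- Shifting the argument by a fixed integer changes `ψ` by finitely many reciprocals that tend to
`0`. Monotonicity squeezes the real shift `x - 1` between the integer shifts `-1` and `N ≥ x`. -/
theorem tendsto_realPolygamma_zero_add_nat_sub {x : ℝ} (hx : 0 < x) :
    Tendsto (fun n : ℕ => realPolygamma 0 (x + n) - realPolygamma 0 (1 + n)) atTop (𝓝 0) := by
  have aux : ∀ y : ℝ, 0 < y → ∀ N : ℕ, Tendsto (fun n : ℕ =>
      realPolygamma 0 (y + n + N) - realPolygamma 0 (y + n)) atTop (𝓝 0) := by
    intro y hy N
    have h : ∀ n : ℕ, realPolygamma 0 (y + n + N) - realPolygamma 0 (y + n)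
        = ∑ k ∈ Finset.range N, (y + n + k)⁻¹ := fun n => by
      rw [realPolygamma_zero_add_nat (by positivity)]; ring
    simp_rw [h]
    rw [← Finset.sum_const_zero (s := Finset.range N)]
    refine tendsto_finsetSum _ fun k _ => tendsto_inv_atTop_zero.comp ?_
    exact tendsto_atTop_add_const_right _ _
      (tendsto_atTop_add_const_left _ _ tendsto_natCast_atTop_atTop)
  obtain ⟨N, hN⟩ := exists_nat_ge x
  have h1 := aux 1 one_pos N
  have h2 := (aux x hx 1).neg
  rw [neg_zero] at h2
  refine tendsto_of_tendsto_of_tendsto_of_le_of_le h2 h1 (fun n => ?_) fun n => ?_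
  · have := monotoneOn_realPolygamma_zero (a := 1 + n) (b := x + n + 1)
      (by simp only [mem_Ioi]; positivity) (by simp only [mem_Ioi]; positivity) (by linarith)
    simp only [Nat.cast_one]
    linarith
  · have := monotoneOn_realPolygamma_zero (a := x + n) (b := 1 + n + N)
      (by simp only [mem_Ioi]; positivity) (by simp only [mem_Ioi]; positivity) (by linarith)
    simp only
    linarith

theorem tendsto_sum_inv_sub_inv {x : ℝ} (hx : 0 < x) :
    Tendsto (fun n : ℕ => ∑ k ∈ Finset.range n, ((1 + k : ℝ)⁻¹ - (x + k)⁻¹)) atTop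
      (𝓝 (realPolygamma 0 x - realPolygamma 0 1)) := by
  have h := (tendsto_realPolygamma_zero_add_nat_sub hx).const_sub
    (realPolygamma 0 x - realPolygamma 0 1)
  rw [sub_zero] at h
  refine h.congr fun n => ?_
  rw [realPolygamma_zero_add_nat hx, realPolygamma_zero_add_nat one_pos, Finset.sum_sub_distrib]
  ring

theorem summable_inv_add_nat_sq {x : ℝ} (hx : 0 < x) : Summable fun k : ℕ => ((x + k) ^ 2)⁻¹ := by
  have h := (Real.summable_one_div_nat_add_rpow x 2).2 one_lt_two
  refine h.congr fun k => ?_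
  rw [abs_of_pos (by positivity), one_div, add_comm]
  norm_cast

theorem summable_inv_sub_inv {x : ℝ} (hx : 0 < x) :
    Summable fun k : ℕ => ((1 + k : ℝ)⁻¹ - (x + k)⁻¹) := by
  set m := min 1 x with hm
  have hm0 : 0 < m := lt_min one_pos hx
  refine .of_norm_bounded ((summable_inv_add_nat_sq hm0).mul_left |x - 1|) fun k => ?_
  have h1 : m ≤ 1 := min_le_left _ _
  have h2 : m ≤ x := min_le_right _ _
  have h : (1 + k : ℝ)⁻¹ - (x + k)⁻¹ = (x - 1) * ((1 + k) * (x + k))⁻¹ := by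
    field_simp
    ring
  rw [h, norm_mul, Real.norm_eq_abs, Real.norm_eq_abs, abs_of_pos (a := (_)⁻¹) (by positivity), sq]
  gcongr

/-- Termwise differentiation of the series for `ψ(y) - ψ(1)`. On `y > x / 2` the differentiated
terms are dominated by their values at `x / 2`. -/
theorem realPolygamma_one_eq_tsum {x : ℝ} (hx : 0 < x) :
    realPolygamma 1 x = ∑' k : ℕ, ((x + k) ^ 2)⁻¹ := by
  have hδ : 0 < x / 2 := by positivity
  have h := hasDerivAt_tsum_of_isPreconnected (summable_inv_add_nat_sq hδ)
    (g := fun (k : ℕ) (y : ℝ) => ((1 + k : ℝ)⁻¹ - (y + k)⁻¹))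
    (g' := fun (k : ℕ) (y : ℝ) => ((y + k) ^ 2)⁻¹) (t := Ioi (x / 2)) (y₀ := x) (y := x)
    isOpen_Ioi isPreconnected_Ioi (fun k y hy => ?_) (fun k y hy => ?_) (by simp [hx])
    (summable_inv_sub_inv hx) (by simp [hx])
  · have h2 : HasDerivAt (fun z => realPolygamma 0 z - realPolygamma 0 1)
        (realPolygamma 1 x) x := (hasDerivAt_realPolygamma 0 hx).sub_const _
    refine h2.unique (h.congr_of_eventuallyEq ?_)
    filter_upwards [lt_mem_nhds hx] with z hz
    exact tendsto_nhds_unique (tendsto_sum_inv_sub_inv hz)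
      (summable_inv_sub_inv hz).hasSum.tendsto_sum_nat
  · have hy' : 0 < y := hδ.trans hy
    convert! (((hasDerivAt_id y).add_const (k : ℝ)).inv (by simp; positivity)).const_sub _ using 1
    simp [neg_div]
  · have hy' : x / 2 < y := hy
    have hy0 : 0 < y := hδ.trans hy
    rw [Real.norm_eq_abs, abs_of_pos (by positivity)]
    gcongr

/-! ### Poles at -1 and linear independence -/

theorem eventually_mem_gammaDomain_neg_one : ∀ᶠ z in 𝓝[≠] (-1 : ℂ), z ∈ gammaDomain := by
  have h2 : ∀ᶠ z in 𝓝[≠] (-1 : ℂ), z ∈ Metric.ball (-1 : ℂ) 1 :=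
    nhdsWithin_le_nhds (Metric.ball_mem_nhds _ one_pos)
  filter_upwards [h2, self_mem_nhdsWithin] with z hz hz1
  have hz1 : z ≠ -1 := hz1
  rw [Metric.mem_ball, dist_eq_norm, sub_neg_eq_add] at hz
  refine mem_gammaDomain.2 ?_
  rintro m rfl
  rcases m with _ | m
  · simp at hz
  · rcases m with _ | m
    · simp at hz1
    · have h3 : (-((m + 1 + 1 : ℕ) : ℂ) + 1) = -((m + 1 : ℕ) : ℂ) := by push_cast; ring
      rw [h3, norm_neg, Complex.norm_natCast] at hz
      push_cast at hz
      have : (0 : ℝ) ≤ m := m.cast_nonneg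
      linarith

/-- `ψ^{(k)}` has a pole of order `k + 1` at `-1`. -/
theorem exists_analyticAt_iteratedDeriv_digamma_neg_one (k : ℕ) :
    ∃ (h : ℂ → ℂ) (C : ℂ), AnalyticAt ℂ h (-1) ∧ C ≠ 0 ∧
      ∀ᶠ z in 𝓝[≠] (-1 : ℂ), iteratedDeriv k Complex.digamma z = h z + C * ((z + 1) ^ (k + 1))⁻¹ := by
  induction k with
  | zero =>
    -- Two uses of the functional equation: `ψ(z) = ψ(z + 2) - 1/z - 1/(z + 1)`, where only the last
    -- term is singular at `-1`.
    refine ⟨fun z => Complex.digamma (z + 2) - z⁻¹, -1, ?_, by simp, ?_⟩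
    · have h1 : AnalyticAt ℂ Complex.digamma (-1 + 2) := analyticOnNhd_digamma _ (by
        convert! ofReal_mem_gammaDomain one_pos using 1; norm_num)
      refine AnalyticAt.sub (AnalyticAt.fun_comp h1 (by fun_prop)) (analyticAt_id.inv (by simp))
    · filter_upwards [eventually_mem_gammaDomain_neg_one] with z hz
      have hd := mem_gammaDomain.1 hz
      have hd' : ∀ m : ℕ, z + 1 ≠ -m := by
        intro m hm
        refine hd (m + 1) ?_
        push_cast
        linear_combination hm
      have e1 := Complex.digamma_apply_add_one z hd
      have e2 := Complex.digamma_apply_add_one (z + 1) hd'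
      have e3 : z + 1 + 1 = z + 2 := by ring
      rw [e3] at e2
      simp only [iteratedDeriv_zero, zero_add, pow_one]
      linear_combination -e1 - e2
  | succ k ih =>
    obtain ⟨h, C, hh, hC, heq⟩ := ih
    refine ⟨deriv h, -((k + 1 : ℕ) : ℂ) * C, hh.deriv,
      mul_ne_zero (neg_ne_zero.2 (Nat.cast_ne_zero.2 k.succ_ne_zero)) hC, ?_⟩
    filter_upwards [eventually_eventually_nhdsWithin.2 heq, self_mem_nhdsWithin,
      nhdsWithin_le_nhds hh.eventually_analyticAt] with z hz hz1 hza
    have hz1 : z ≠ -1 := hz1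
    have hne : z + 1 ≠ 0 := fun h0 => hz1 (eq_neg_of_add_eq_zero_left h0)
    rw [isOpen_compl_singleton.nhdsWithin_eq hz1] at hz
    rw [iteratedDeriv_succ, EventuallyEq.deriv_eq hz]
    have h1 : HasDerivAt (fun z : ℂ => (z + 1) ^ (k + 1)) (((k + 1 : ℕ) : ℂ) * (z + 1) ^ k * 1) z := by
      simpa using ((hasDerivAt_id z).add_const 1).fun_pow (k + 1)
    have h2 := hza.differentiableAt.hasDerivAt.fun_add ((h1.fun_inv (pow_ne_zero _ hne)).const_mul C)
    rw [h2.deriv]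
    congr 1
    field_simp
    ring

theorem exists_tendsto_pow_mul_iteratedDeriv_digamma (k : ℕ) :
    ∃ C : ℂ, C ≠ 0 ∧ Tendsto (fun z => (z + 1) ^ (k + 1) * iteratedDeriv k Complex.digamma z)
      (𝓝[≠] (-1 : ℂ)) (𝓝 C) := by
  obtain ⟨h, C, hh, hC, heq⟩ := exists_analyticAt_iteratedDeriv_digamma_neg_one k
  refine ⟨C, hC, ?_⟩
  have h1 : ContinuousAt (fun z : ℂ => (z + 1) ^ (k + 1) * h z + C) (-1) := by
    have := hh.continuousAt
    fun_prop
  have h2 : Tendsto (fun z : ℂ => (z + 1) ^ (k + 1) * h z + C) (𝓝[≠] (-1 : ℂ)) (𝓝 C) := by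
    have h3 := h1.tendsto.mono_left (nhdsWithin_le_nhds (s := {-1}ᶜ))
    simpa using h3
  refine h2.congr' ?_
  filter_upwards [heq, self_mem_nhdsWithin] with z hz hz1
  have hz1 : z ≠ -1 := hz1
  have hne : z + 1 ≠ 0 := fun h0 => hz1 (eq_neg_of_add_eq_zero_left h0)
  rw [hz]
  field_simp

theorem tendsto_pow_mul_iteratedDeriv_digamma_of_lt {k n : ℕ} (hkn : k + 1 < n) :
    Tendsto (fun z => (z + 1) ^ n * iteratedDeriv k Complex.digamma z) (𝓝[≠] (-1 : ℂ)) (𝓝 0) := by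
  obtain ⟨C, -, hC⟩ := exists_tendsto_pow_mul_iteratedDeriv_digamma k
  obtain ⟨d, rfl⟩ := Nat.exists_eq_add_of_lt hkn
  have h1 : Tendsto (fun z : ℂ => (z + 1) ^ (d + 1)) (𝓝[≠] (-1 : ℂ)) (𝓝 0) := by
    have h2 : ContinuousAt (fun z : ℂ => (z + 1) ^ (d + 1)) (-1) := by fun_prop
    simpa using h2.tendsto.mono_left (nhdsWithin_le_nhds (s := {-1}ᶜ))
  have h3 := h1.mul hC
  rw [zero_mul] at h3
  refine h3.congr fun z => ?_
  ring

/-- The functions `1`, `x` and `x ^ (i + 2) ψ^{(i + 1)}(x)`, `i < m`, are linearly independent on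
the positive half-line. -/
theorem eq_zero_of_digamma_relation (m : ℕ) (A B : ℂ) (a : ℕ → ℂ)
    (h : ∀ x : ℝ, 0 < x → A + B * x + ∑ i ∈ Finset.range m,
      a i * ((x : ℂ) ^ (i + 2) * iteratedDeriv (i + 1) Complex.digamma x) = 0) :
    A = 0 ∧ B = 0 ∧ ∀ i < m, a i = 0 := by
  induction m with
  | zero =>
    have h1 := h 1 one_pos
    have h2 := h 2 two_pos
    simp only [Finset.range_zero, Finset.sum_empty, add_zero, Complex.ofReal_one,
      Complex.ofReal_ofNat] at h1 h2
    exact ⟨by linear_combination 2 * h1 - h2, by linear_combination h2 - h1, by simp⟩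
  | succ m ih =>
    set f : ℂ → ℂ := fun z => A + B * z + ∑ i ∈ Finset.range (m + 1),
      a i * (z ^ (i + 2) * iteratedDeriv (i + 1) Complex.digamma z) with hf
    have hfa : AnalyticOnNhd ℂ f gammaDomain := fun z hz => by
      refine AnalyticAt.add (by fun_prop) (Finset.analyticAt_fun_sum _ fun i _ => ?_)
      have := analyticOnNhd_iteratedDeriv_digamma (i + 1) z hz
      fun_prop
    have hfreq : ∃ᶠ z in 𝓝[≠] ((1 : ℝ) : ℂ), f z = 0 := by
      have h1 : Tendsto (fun x : ℝ => (x : ℂ)) (𝓝[≠] 1) (𝓝[≠] ((1 : ℝ) : ℂ)) :=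
        tendsto_nhdsWithin_of_tendsto_nhds_of_eventually_within _
          (Complex.continuous_ofReal.continuousAt.tendsto.mono_left nhdsWithin_le_nhds)
          (by
            filter_upwards [self_mem_nhdsWithin] with x hx
            simpa using hx)
      refine h1.frequently (Eventually.frequently ?_)
      filter_upwards [nhdsWithin_le_nhds (lt_mem_nhds one_pos)] with x hx
      exact h x hx
    have hzero : EqOn f 0 gammaDomain :=
      hfa.eqOn_zero_of_preconnected_of_frequently_eq_zero isPreconnected_gammaDomain
        (ofReal_mem_gammaDomain one_pos) hfreq
    -- Multiply by `(z + 1) ^ (m + 2)`, the order of the highest pole, and let `z → -1`: only the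
    -- term with `a m` survives, and `z ^ (m + 2)` does not vanish there.
    have ham : a m = 0 := by
      obtain ⟨C, hC, hlim⟩ := exists_tendsto_pow_mul_iteratedDeriv_digamma (m + 1)
      have hid : ∀ g : ℂ → ℂ, Continuous g → Tendsto g (𝓝[≠] (-1 : ℂ)) (𝓝 (g (-1))) :=
        fun g hg => hg.continuousAt.tendsto.mono_left nhdsWithin_le_nhds
      have t1 := hid (fun z => (z + 1) ^ (m + 2) * (A + B * z)) (by fun_prop)
      have t2 : Tendsto (fun z => ∑ i ∈ Finset.range m, a i * z ^ (i + 2) *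
          ((z + 1) ^ (m + 2) * iteratedDeriv (i + 1) Complex.digamma z)) (𝓝[≠] (-1 : ℂ)) (𝓝 0) := by
        rw [← Finset.sum_const_zero (s := Finset.range m)]
        refine tendsto_finsetSum _ fun i hi => ?_
        have := (hid (fun z => a i * z ^ (i + 2)) (by fun_prop)).mul
          (tendsto_pow_mul_iteratedDeriv_digamma_of_lt (k := i + 1) (n := m + 2)
            (by have := Finset.mem_range.1 hi; omega))
        rwa [mul_zero] at this
      have t3 := (hid (fun z => a m * z ^ (m + 2)) (by fun_prop)).mul hlim
      have t4 := (t1.add t2).add t3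
      have t5 := t4.congr' (f₂ := fun _ => 0) (by
        filter_upwards [eventually_mem_gammaDomain_neg_one] with z hz
        have h0 : f z = 0 := hzero hz
        rw [hf] at h0
        simp only [Finset.sum_range_succ] at h0
        rw [← mul_zero ((z + 1) ^ (m + 2)), ← h0, ← add_assoc, mul_add _ (_ + _), mul_add _ (_ + _),
          Finset.mul_sum]
        congr 1
        · congr 1
          exact Finset.sum_congr rfl fun i _ => by ring
        · ring)
      have t6 := tendsto_nhds_unique t5 tendsto_const_nhds
      simpa [hC] using t6
    obtain ⟨hA, hB, hi⟩ := ih fun x hx => by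
      simpa [Finset.sum_range_succ, ham] using h x hx
    refine ⟨hA, hB, fun i him => ?_⟩
    rcases Nat.lt_succ_iff_lt_or_eq.1 him with h1 | rfl
    exacts [hi i h1, ham]

/-! ### Elementary rational integrals -/

theorem integral_Ioi_inv_sq_add_sq {a : ℝ} (ha : 0 < a) :
    IntegrableOn (fun x : ℝ => (x ^ 2 + a ^ 2)⁻¹) (Ioi 0) ∧
      ∫ x in Ioi (0 : ℝ), (x ^ 2 + a ^ 2)⁻¹ = Real.pi / (2 * a) := by
  have hd : ∀ x ∈ Ici (0 : ℝ), HasDerivAt (fun x => a⁻¹ * Real.arctan (x / a))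
      ((x ^ 2 + a ^ 2)⁻¹) x := fun x _ => by
    convert! (((hasDerivAt_id x).div_const a).arctan).const_mul a⁻¹ using 1
    simp only [id]
    field_simp
    ring
  have ht : Tendsto (fun x => a⁻¹ * Real.arctan (x / a)) atTop (𝓝 (a⁻¹ * (Real.pi / 2))) :=
    ((tendsto_nhds_of_tendsto_nhdsWithin Real.tendsto_arctan_atTop).comp
      (tendsto_id.atTop_div_const ha)).const_mul _
  have hp : ∀ x ∈ Ioi (0 : ℝ), 0 ≤ (x ^ 2 + a ^ 2)⁻¹ := fun x _ => by positivity
  refine ⟨integrableOn_Ioi_deriv_of_nonneg' hd hp ht, ?_⟩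
  rw [integral_Ioi_of_hasDerivAt_of_nonneg' hd hp ht]
  simp
  field_simp

theorem tendsto_div_sq_add_sq_pow (a : ℝ) (n : ℕ) (hn : n ≠ 0) :
    Tendsto (fun x : ℝ => x / (x ^ 2 + a ^ 2) ^ n) atTop (𝓝 0) := by
  refine squeeze_zero' (g := fun x : ℝ => x⁻¹) ?_ ?_ tendsto_inv_atTop_zero
  · filter_upwards [eventually_gt_atTop 0] with x hx
    positivity
  · filter_upwards [eventually_ge_atTop 1] with x hx
    have h1 : 1 ≤ x ^ 2 + a ^ 2 := by nlinarith [sq_nonneg a]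
    have h2 : x ^ 2 + a ^ 2 ≤ (x ^ 2 + a ^ 2) ^ n := le_self_pow₀ h1 hn
    rw [div_le_iff₀ (by positivity), inv_mul_eq_div, le_div_iff₀ (by positivity)]
    nlinarith [sq_nonneg a]

theorem integrableOn_inv_sq_add_sq_pow {a : ℝ} (ha : 0 < a) (n : ℕ) (hn : n ≠ 0) :
    IntegrableOn (fun x : ℝ => ((x ^ 2 + a ^ 2) ^ n)⁻¹) (Ioi 0) := by
  obtain ⟨k, rfl⟩ := Nat.exists_eq_succ_of_ne_zero hn
  refine Integrable.mono' ((integral_Ioi_inv_sq_add_sq ha).1.const_mul (((a ^ 2) ^ k)⁻¹))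
    (by fun_prop) (ae_of_all _ fun x => ?_)
  rw [Real.norm_eq_abs, abs_of_pos (by positivity), pow_succ, mul_inv]
  gcongr
  nlinarith [sq_nonneg x]

/-- The function `x / (x² + a²)` vanishes at both ends, so its derivative integrates to `0`; this
reduces the square to the first power. -/
theorem integral_Ioi_inv_sq_add_sq_sq {a : ℝ} (ha : 0 < a) :
    ∫ x in Ioi (0 : ℝ), ((x ^ 2 + a ^ 2) ^ 2)⁻¹ = Real.pi / (4 * a ^ 3) := by
  have hd : ∀ x ∈ Ici (0 : ℝ), HasDerivAt (fun x => x / (x ^ 2 + a ^ 2) ^ 1)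
      (2 * a ^ 2 * ((x ^ 2 + a ^ 2) ^ 2)⁻¹ - (x ^ 2 + a ^ 2)⁻¹) x := fun x _ => by
    have h1 : HasDerivAt (fun x : ℝ => (x ^ 2 + a ^ 2) ^ 1) (2 * x) x := by
      simpa using ((hasDerivAt_id x).pow 2).add_const (a ^ 2)
    convert! (hasDerivAt_id x).div h1 (by positivity) using 1
    simp only [id]
    field_simp
    ring
  have i1 := (integrableOn_inv_sq_add_sq_pow ha 2 two_ne_zero).const_mul (2 * a ^ 2)
  have i2 := (integral_Ioi_inv_sq_add_sq ha).1
  have h := integral_Ioi_of_hasDerivAt_of_tendsto' hd (i1.sub i2)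
    (tendsto_div_sq_add_sq_pow a 1 one_ne_zero)
  rw [integral_sub i1 i2, integral_const_mul, (integral_Ioi_inv_sq_add_sq ha).2] at h
  simp only [zero_div, sub_zero] at h
  field_simp at h ⊢
  linear_combination h

theorem integral_Ioi_div_sq_add_sq_sq {a : ℝ} (ha : 0 < a) :
    IntegrableOn (fun x : ℝ => x / (x ^ 2 + a ^ 2) ^ 2) (Ioi 0) ∧
      ∫ x in Ioi (0 : ℝ), x / (x ^ 2 + a ^ 2) ^ 2 = 1 / (2 * a ^ 2) := by
  have hd : ∀ x ∈ Ici (0 : ℝ), HasDerivAt (fun x => -(1 / 2) * (x ^ 2 + a ^ 2)⁻¹)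
      (x / (x ^ 2 + a ^ 2) ^ 2) x := fun x _ => by
    have h1 : HasDerivAt (fun x : ℝ => (x ^ 2 + a ^ 2)) (2 * x) x := by
      simpa using ((hasDerivAt_id x).pow 2).add_const (a ^ 2)
    convert! (h1.fun_inv (by positivity)).const_mul (-(1 / 2) : ℝ) using 1
    field_simp
  have ht : Tendsto (fun x => -(1 / 2) * (x ^ 2 + a ^ 2)⁻¹) atTop (𝓝 (-(1 / 2) * 0)) :=
    (tendsto_inv_atTop_zero.comp
      (tendsto_atTop_add_const_right _ _ (tendsto_pow_atTop two_ne_zero))).const_mul _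
  have hp : ∀ x ∈ Ioi (0 : ℝ), 0 ≤ x / (x ^ 2 + a ^ 2) ^ 2 := fun x hx => by
    have : 0 < x := hx
    positivity
  refine ⟨integrableOn_Ioi_deriv_of_nonneg' hd hp ht, ?_⟩
  rw [integral_Ioi_of_hasDerivAt_of_nonneg' hd hp ht]
  field_simp
  simp

theorem integral_Ioi_sq_div_sq_add_sq_cube {a : ℝ} (ha : 0 < a) :
    IntegrableOn (fun x : ℝ => x ^ 2 / (x ^ 2 + a ^ 2) ^ 3) (Ioi 0) ∧
      ∫ x in Ioi (0 : ℝ), x ^ 2 / (x ^ 2 + a ^ 2) ^ 3 = Real.pi / (16 * a ^ 3) := by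
  have hd : ∀ x ∈ Ici (0 : ℝ), HasDerivAt (fun x => x / (x ^ 2 + a ^ 2) ^ 2)
      (((x ^ 2 + a ^ 2) ^ 2)⁻¹ - 4 * (x ^ 2 / (x ^ 2 + a ^ 2) ^ 3)) x := fun x _ => by
    have h1 : HasDerivAt (fun x : ℝ => (x ^ 2 + a ^ 2) ^ 2) (2 * (x ^ 2 + a ^ 2) * (2 * x)) x := by
      simpa using (((hasDerivAt_id x).fun_pow 2).add_const (a ^ 2)).fun_pow 2
    convert! (hasDerivAt_id x).div h1 (by positivity) using 1
    simp only [id]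
    field_simp
    ring
  have i1 := integrableOn_inv_sq_add_sq_pow ha 2 two_ne_zero
  have i2 : IntegrableOn (fun x : ℝ => x ^ 2 / (x ^ 2 + a ^ 2) ^ 3) (Ioi 0) := by
    refine Integrable.mono' i1 (Measurable.aestronglyMeasurable (by fun_prop)) (ae_of_all _ fun x => ?_)
    rw [Real.norm_eq_abs, abs_of_nonneg (by positivity), div_le_iff₀ (by positivity)]
    field_simp
    nlinarith [sq_nonneg a]
  refine ⟨i2, ?_⟩
  have h := integral_Ioi_of_hasDerivAt_of_tendsto' hd (i1.sub (i2.const_mul 4))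
    (tendsto_div_sq_add_sq_pow a 2 two_ne_zero)
  rw [integral_sub i1 (i2.const_mul 4), integral_const_mul, integral_Ioi_inv_sq_add_sq_sq ha] at h
  simp only [zero_div, sub_zero] at h
  field_simp at h ⊢
  linear_combination -h

/-- Partial fractions in `x²`; their denominators `a² - c²` force the separate case `a = c`. With `a
= 2π(n + 1)` the value is a multiple of a term of the series of `ψ'(c / 2π)`. -/
theorem integral_Ioi_sq_div_sq_add_sq_sq_mul {a c : ℝ} (ha : 0 < a) (hc : 0 < c) :
    IntegrableOn (fun x : ℝ => x / (x ^ 2 + c ^ 2) ^ 2 * (2 * x / (x ^ 2 + a ^ 2))) (Ioi 0) ∧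
      ∫ x in Ioi (0 : ℝ), x / (x ^ 2 + c ^ 2) ^ 2 * (2 * x / (x ^ 2 + a ^ 2)) =
        Real.pi / (2 * c * (a + c) ^ 2) := by
  rcases eq_or_ne a c with rfl | hac
  · obtain ⟨h1, h2⟩ := integral_Ioi_sq_div_sq_add_sq_cube ha
    have e : (fun x : ℝ => x / (x ^ 2 + a ^ 2) ^ 2 * (2 * x / (x ^ 2 + a ^ 2))) =
        fun x => 2 * (x ^ 2 / (x ^ 2 + a ^ 2) ^ 3) := by
      ext x
      field_simp
    rw [e]
    refine ⟨h1.const_mul 2, ?_⟩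
    rw [integral_const_mul, h2]
    field_simp
    ring
  · have hD : a ^ 2 - c ^ 2 ≠ 0 := by
      rw [sq_sub_sq]
      exact mul_ne_zero (by positivity) (sub_ne_zero.2 hac)
    set D := a ^ 2 - c ^ 2 with hDdef
    have e : (fun x : ℝ => x / (x ^ 2 + c ^ 2) ^ 2 * (2 * x / (x ^ 2 + a ^ 2))) =
        fun x => 2 * a ^ 2 / D ^ 2 * (x ^ 2 + c ^ 2)⁻¹
          - 2 * c ^ 2 / D * ((x ^ 2 + c ^ 2) ^ 2)⁻¹
          - 2 * a ^ 2 / D ^ 2 * (x ^ 2 + a ^ 2)⁻¹ := by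
      ext x
      field_simp
      rw [hDdef]
      ring
    have i1 := (integral_Ioi_inv_sq_add_sq hc).1.const_mul (2 * a ^ 2 / D ^ 2)
    have i2 := (integrableOn_inv_sq_add_sq_pow hc 2 two_ne_zero).const_mul (2 * c ^ 2 / D)
    have i3 := (integral_Ioi_inv_sq_add_sq ha).1.const_mul (2 * a ^ 2 / D ^ 2)
    rw [e]
    refine ⟨(i1.sub i2).sub i3, ?_⟩
    rw [integral_sub (by exact i1.sub i2) i3, integral_sub i1 i2, integral_const_mul, integral_const_mul,
      integral_const_mul, (integral_Ioi_inv_sq_add_sq hc).2, (integral_Ioi_inv_sq_add_sq ha).2,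
      integral_Ioi_inv_sq_add_sq_sq hc]
    field_simp
    rw [hDdef]
    ring

/-! ### Convergence, scaling and differentiation of the integrals -/

theorem integrandMinus_one_one (j : ℕ) (b μ x : ℝ) :
    integrandMinus 1 j 1 b μ x = x / ((x ^ 2 + b ^ 2) ^ j * (Real.exp (μ * x) - 1)) := by
  simp [integrandMinus]

theorem measurable_integrandMinus (n j s : ℕ) (b μ : ℝ) : Measurable (integrandMinus n j s b μ) := by
  unfold integrandMinus
  fun_prop

theorem mul_le_exp_sub_one (μ x : ℝ) : μ * x ≤ Real.exp (μ * x) - 1 := by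
  linarith [Real.add_one_le_exp (μ * x)]

theorem integrandMinus_nonneg {j : ℕ} {b μ x : ℝ} (hμ : 0 < μ) (hx : 0 < x) :
    0 ≤ integrandMinus 1 j 1 b μ x := by
  rw [integrandMinus_one_one]
  have := (mul_pos hμ hx).trans_le (mul_le_exp_sub_one μ x)
  positivity

/-- The bound `μx ≤ e^{μx} - 1` cancels the numerator and leaves `μ⁻¹ (x² + b²)^{-j}`. -/
theorem integrableOn_integrandMinus {j : ℕ} (hj : j ≠ 0) {b μ : ℝ} (hb : 0 < b) (hμ : 0 < μ) :
    IntegrableOn (integrandMinus 1 j 1 b μ) (Ioi 0) := by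
  refine Integrable.mono' ((integrableOn_inv_sq_add_sq_pow hb j hj).const_mul μ⁻¹)
    (measurable_integrandMinus _ _ _ _ _).aestronglyMeasurable ?_
  filter_upwards [ae_restrict_mem measurableSet_Ioi] with x hx
  have hx : 0 < x := hx
  rw [Real.norm_eq_abs, abs_of_nonneg (integrandMinus_nonneg hμ hx), integrandMinus_one_one]
  have h1 := mul_le_exp_sub_one μ x
  have h2 := (mul_pos hμ hx).trans_le h1
  rw [← mul_inv, div_le_iff₀ (by positivity), inv_mul_eq_div, le_div_iff₀ (by positivity)]
  calc x * (μ * (x ^ 2 + b ^ 2) ^ j) = (x ^ 2 + b ^ 2) ^ j * (μ * x) := by ring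
    _ ≤ _ := by gcongr

theorem integralMinus_scale (j : ℕ) (hj : 1 ≤ j) {b μ : ℝ} (hμ : 0 < μ) :
    integralMinus 1 j 1 b μ = μ ^ (2 * j - 2) * normIntegralMinus 1 j 1 (b * μ) := by
  have h := integral_comp_mul_left_Ioi (integrandMinus 1 j 1 (b * μ) 1) 0 hμ
  rw [mul_zero, smul_eq_mul] at h
  obtain ⟨k, rfl⟩ := Nat.exists_eq_add_of_le hj
  have e : ∀ x, integrandMinus 1 (1 + k) 1 (b * μ) 1 (μ * x)
      = (μ ^ (2 * k) * μ)⁻¹ * integrandMinus 1 (1 + k) 1 b μ x := fun x => by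
    rw [integrandMinus_one_one, integrandMinus_one_one, one_mul,
      show (μ * x) ^ 2 + (b * μ) ^ 2 = μ ^ 2 * (x ^ 2 + b ^ 2) by ring, mul_pow]
    rw [div_eq_mul_inv, div_eq_mul_inv, mul_inv, mul_inv, mul_inv, mul_inv, ← pow_mul,
      show 2 * (1 + k) = 2 * k + 2 by ring, pow_add]
    field_simp
  simp_rw [e] at h
  rw [integral_const_mul] at h
  rw [normIntegralMinus, integralMinus, integralMinus, show 2 * (1 + k) - 2 = 2 * k by omega]
  rw [inv_mul_eq_div, inv_mul_eq_div, div_eq_div_iff (by positivity) hμ.ne'] at h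
  refine mul_right_cancel₀ hμ.ne' ?_
  linear_combination h

/-- Dominated differentiation for `b` in `(c/2, 2c)`: the integrand decreases in `b`, so `b = c/2`
bounds it, while `2c` bounds the outer factor `b`. -/
theorem hasDerivAt_normIntegralMinus {j : ℕ} (hj : j ≠ 0) {c : ℝ} (hc : 0 < c) :
    HasDerivAt (normIntegralMinus 1 j 1) (-2 * j * c * normIntegralMinus 1 (j + 1) 1 c) c := by
  have hc2 : 0 < c / 2 := by positivity
  have h := (hasDerivAt_integral_of_dominated_loc_of_deriv_le
    (μ := volume.restrict (Ioi (0 : ℝ))) (F := fun b x => integrandMinus 1 j 1 b 1 x)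
    (F' := fun b x => -2 * j * b * integrandMinus 1 (j + 1) 1 b 1 x) (x₀ := c)
    (s := Ioo (c / 2) (2 * c))
    (bound := fun x => 2 * j * (2 * c) * integrandMinus 1 (j + 1) 1 (c / 2) 1 x)
    (Ioo_mem_nhds (by linarith) (by linarith))
    (Eventually.of_forall fun b => (measurable_integrandMinus _ _ _ _ _).aestronglyMeasurable)
    (integrableOn_integrandMinus hj hc one_pos)
    ((measurable_integrandMinus _ _ _ _ _).aestronglyMeasurable.const_mul _) ?_
    ((integrableOn_integrandMinus j.succ_ne_zero hc2 one_pos).const_mul _) ?_).2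
  · rwa [integral_const_mul] at h
  · filter_upwards [ae_restrict_mem measurableSet_Ioi] with x hx b hb
    have hx : 0 < x := hx
    have hb0 : 0 < b := hc2.trans hb.1
    have h2 := (mul_pos one_pos hx).trans_le (mul_le_exp_sub_one 1 x)
    rw [norm_mul, Real.norm_eq_abs, Real.norm_eq_abs,
      abs_of_nonneg (integrandMinus_nonneg one_pos hx), neg_mul, neg_mul, abs_neg,
      abs_of_nonneg (by positivity), integrandMinus_one_one, integrandMinus_one_one]
    have hb1 := hb.1
    have hb2 := hb.2
    gcongr
  · filter_upwards [ae_restrict_mem measurableSet_Ioi] with x hx b hb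
    have hx : 0 < x := hx
    have hb0 : 0 < b := hc2.trans hb.1
    have h2 := (mul_pos one_pos hx).trans_le (mul_le_exp_sub_one 1 x)
    simp only [integrandMinus_one_one]
    obtain ⟨k, rfl⟩ := Nat.exists_eq_succ_of_ne_zero hj
    have h3 : HasDerivAt (fun b : ℝ => (x ^ 2 + b ^ 2) ^ (k + 1) * (Real.exp (1 * x) - 1))
        (((k + 1 : ℕ) : ℝ) * (x ^ 2 + b ^ 2) ^ k * (2 * b) * (Real.exp (1 * x) - 1)) b := by
      simpa using ((((hasDerivAt_id b).fun_pow 2).const_add (x ^ 2)).fun_pow (k + 1)).mul_const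
        (Real.exp (1 * x) - 1)
    convert! (hasDerivAt_const b x).div h3 (by positivity) using 1
    simp only [Nat.succ_eq_add_one]
    field_simp
    ring

/-! ### Partial fractions of 1 / (e^x - 1) and the case j = 2 -/

/-- The cotangent series at `z = -ix / 2π`, chosen so that `e^{2πiz} = e^x`. Both sides are `2πi`
times real quantities. -/
theorem hasSum_inv_exp_sub_one {x : ℝ} (hx : 0 < x) :
    HasSum (fun n : ℕ => 2 * x / (x ^ 2 + (2 * Real.pi * (n + 1)) ^ 2))
      (1 / (Real.exp x - 1) - 1 / x + 1 / 2) := by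
  have hsum : Summable fun n : ℕ => 2 * x / (x ^ 2 + (2 * Real.pi * (n + 1)) ^ 2) := by
    refine .of_norm_bounded ((summable_inv_add_nat_sq one_pos).mul_left (2 * x)) fun n => ?_
    rw [Real.norm_eq_abs, abs_of_pos (by positivity), div_eq_mul_inv]
    gcongr
    have h1 : (1 + n : ℝ) ≤ 2 * Real.pi * (n + 1) := by
      nlinarith [Real.pi_gt_three, (Nat.cast_nonneg n : (0 : ℝ) ≤ n)]
    have h2 : (1 + n : ℝ) ^ 2 ≤ (2 * Real.pi * (n + 1)) ^ 2 := by gcongr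
    nlinarith [sq_nonneg x]
  have hpi : (Real.pi : ℂ) ≠ 0 := Complex.ofReal_ne_zero.2 Real.pi_ne_zero
  have hxc : (x : ℂ) ≠ 0 := Complex.ofReal_ne_zero.2 hx.ne'
  obtain ⟨z, hz⟩ : ∃ z : ℂ, z = ((-(x / (2 * Real.pi)) : ℝ) : ℂ) * Complex.I := ⟨_, rfl⟩
  have hzim : z.im = -(x / (2 * Real.pi)) := by
    rw [hz, Complex.im_ofReal_mul, Complex.I_im, mul_one]
  have hzmem : z ∈ Complex.integerComplement := by
    rintro ⟨n, hn⟩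
    have h1 := congrArg Complex.im hn
    rw [hzim, Complex.intCast_im] at h1
    have : 0 < x / (2 * Real.pi) := by positivity
    linarith
  have h := cot_series_rep' hzmem
  have hterm : ∀ n : ℕ, 1 / (z - (n + 1)) + 1 / (z + (n + 1))
      = 2 * Real.pi * Complex.I *
        ((2 * x / (x ^ 2 + (2 * Real.pi * (n + 1)) ^ 2) : ℝ) : ℂ) := fun n => by
    have n1 : z - (n + 1) ≠ 0 := fun h0 => by
      have := congrArg Complex.im h0
      simp [hzim, hx.ne', Real.pi_ne_zero] at this
    have n2 : z + (n + 1) ≠ 0 := fun h0 => by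
      have := congrArg Complex.im h0
      simp [hzim, hx.ne', Real.pi_ne_zero] at this
    have n3 : ((x ^ 2 + (2 * Real.pi * (n + 1)) ^ 2 : ℝ) : ℂ) ≠ 0 :=
      Complex.ofReal_ne_zero.2 (by positivity)
    push_cast at n3 ⊢
    have h2z : 2 * Real.pi * z = -x * Complex.I := by
      rw [hz]; push_cast; field_simp
    have hx' : (x : ℂ) = 2 * Real.pi * z * Complex.I := by
      rw [h2z]; linear_combination (x : ℂ) * Complex.I_sq
    have n4 : (x : ℂ) ^ 2 + (2 * Real.pi * (n + 1)) ^ 2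
        = -(4 * Real.pi ^ 2 * ((z - (n + 1)) * (z + (n + 1)))) := by
      rw [hx']; linear_combination 4 * (Real.pi : ℂ) ^ 2 * z ^ 2 * Complex.I_sq
    rw [n4, hx']
    field_simp
    linear_combination (8 * z) * Complex.I_sq
  simp_rw [hterm] at h
  rw [tsum_mul_left, ← Complex.ofReal_tsum, Complex.cot_pi_eq_exp_ratio] at h
  have hexp : 2 * Real.pi * Complex.I * z = (x : ℂ) := by
    rw [hz]; push_cast; field_simp; linear_combination (-1 : ℂ) * Complex.I_sq
  have he : 0 < Real.exp x - 1 := by linarith [Real.add_one_le_exp x]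
  have hec : (Real.exp x : ℂ) - 1 ≠ 0 := by exact_mod_cast he.ne'
  have hec' : 1 - (Real.exp x : ℂ) ≠ 0 := by rw [← neg_ne_zero, neg_sub]; exact hec
  rw [hexp, ← Complex.ofReal_exp] at h
  have hval : ∑' n : ℕ, 2 * x / (x ^ 2 + (2 * Real.pi * (n + 1)) ^ 2)
      = 1 / (Real.exp x - 1) - 1 / x + 1 / 2 := by
    have h2 : (2 * Real.pi * Complex.I) *
        ((∑' n : ℕ, 2 * x / (x ^ 2 + (2 * Real.pi * (n + 1)) ^ 2) : ℝ) : ℂ)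
        = (2 * Real.pi * Complex.I) * ((1 / (Real.exp x - 1) - 1 / x + 1 / 2 : ℝ) : ℂ) := by
      rw [← h, hz]
      set E : ℂ := (Real.exp x : ℂ) with hE
      push_cast
      rw [← Complex.ofReal_exp, ← hE]
      have e1 : 1 / (-((x : ℂ) / (2 * Real.pi)) * Complex.I) = 2 * Real.pi * Complex.I / x := by
        field_simp
        linear_combination -Complex.I_sq
      have e2 : (E + 1) / (Complex.I * (1 - E)) = Complex.I * (E + 1) / (E - 1) := by
        field_simp
        linear_combination (E ^ 2 - 1) * Complex.I_sq
      rw [e1, e2]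
      field_simp
      ring
    exact_mod_cast mul_left_cancel₀ (by simp [hpi]) h2
  rw [← hval]
  exact hsum.hasSum

/-- Insert `1/(e^x - 1) = 1/x - 1/2 + ∑ 2x / (x² + (2π(n + 1))²)` and integrate termwise; positivity
of the terms justifies the exchange. The sum lacks the `k = 0` term of `ψ'(y)`, and that `y⁻²` turns
the contribution `π / 4c³` of `1/x` into `-π / 4c³`. -/
theorem normIntegralMinus_two {c : ℝ} (hc : 0 < c) :
    normIntegralMinus 1 2 1 c = -(1 / 4) * (Real.pi / c ^ 3) - 1 / 4 * (1 / c ^ 2)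
      + 1 / 8 * (1 / (c * Real.pi)) * realPolygamma 1 (c / (2 * Real.pi)) := by
  have hpi := Real.pi_pos
  set F : ℕ → ℝ → ℝ := fun n x =>
    x / (x ^ 2 + c ^ 2) ^ 2 * (2 * x / (x ^ 2 + (2 * Real.pi * (n + 1)) ^ 2)) with hF
  have hFi := fun n : ℕ => integral_Ioi_sq_div_sq_add_sq_sq_mul
    (a := 2 * Real.pi * (n + 1)) (by positivity) hc
  set y := c / (2 * Real.pi) with hy
  have hy0 : 0 < y := by positivity
  have hval : ∀ n : ℕ, ∫ x in Ioi 0, F n x = 1 / (8 * Real.pi * c) * ((y + (n + 1 : ℕ)) ^ 2)⁻¹ :=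
    fun n => by
      rw [hF, (hFi n).2, show c = y * (2 * Real.pi) by rw [hy]; field_simp]
      push_cast
      field_simp
      ring
  have hs0 := summable_inv_add_nat_sq hy0
  have hs1 : HasSum (fun n => ∫ x in Ioi 0, F n x)
      (1 / (8 * Real.pi * c) * (realPolygamma 1 y - (y ^ 2)⁻¹)) := by
    simp_rw [hval]
    refine HasSum.mul_left _ ?_
    rw [realPolygamma_one_eq_tsum hy0]
    have := (hasSum_nat_add_iff' 1).2 hs0.hasSum
    simpa using this
  have hs2 := hasSum_integral_of_summable_integral_norm (fun n => (hFi n).1) (by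
    refine hs1.summable.congr fun n => setIntegral_congr_fun measurableSet_Ioi fun x hx => ?_
    have hx : 0 < x := hx
    simp only [hF]
    rw [Real.norm_eq_abs, abs_of_nonneg (by positivity)])
  have h1 := hs2.unique hs1
  have h2 : ∫ x in Ioi (0 : ℝ), ∑' n, F n x = ∫ x in Ioi (0 : ℝ), (integrandMinus 1 2 1 c 1 x
      - (((x ^ 2 + c ^ 2) ^ 2)⁻¹ - 1 / 2 * (x / (x ^ 2 + c ^ 2) ^ 2))) := by
    refine setIntegral_congr_fun measurableSet_Ioi fun x hx => ?_
    have hx : 0 < x := hx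
    simp only [hF]
    have he : 0 < Real.exp x - 1 := by linarith [Real.add_one_le_exp x]
    rw [tsum_mul_left, (hasSum_inv_exp_sub_one hx).tsum_eq, integrandMinus_one_one, one_mul]
    field_simp
    ring
  have i1 := integrableOn_inv_sq_add_sq_pow hc 2 two_ne_zero
  have i2 := (integral_Ioi_div_sq_add_sq_sq hc).1.const_mul (1 / 2)
  rw [integral_sub (integrableOn_integrandMinus two_ne_zero hc one_pos) (by exact i1.sub i2),
    integral_sub i1 i2, integral_const_mul, integral_Ioi_inv_sq_add_sq_sq hc,
    (integral_Ioi_div_sq_add_sq_sq hc).2] at h2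
  rw [hF] at h2
  rw [h2] at h1
  rw [normIntegralMinus, integralMinus]
  rw [show (y ^ 2)⁻¹ = 4 * Real.pi ^ 2 / c ^ 2 by rw [hy]; field_simp; norm_num] at h1
  rw [sub_eq_iff_eq_add] at h1
  rw [h1]
  field_simp
  ring

/-! ### The recursion as a differential identity -/

/-- The summands of `polygammaExpansion (m + 1)`, up to the coefficients. -/
noncomputable def polygammaTerm (m k : ℕ) (c : ℝ) : ℝ :=
  (c ^ (2 * m - k - 1) * Real.pi ^ (k + 1))⁻¹ * realPolygamma (k + 1) (c / (2 * Real.pi))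

/-- Reindexing by `j = m + 1`, `i = k + 1`; for `k < m` the exponent `2m - k - 1` is not truncated.
-/
theorem polygammaExpansion_succ (m : ℕ) (g : ℤ → ℝ) (c : ℝ) :
    polygammaExpansion (m + 1) g c = - g (-1) * Real.pi * (c ^ (2 * m + 1))⁻¹
      - g 0 * (c ^ (2 * m))⁻¹
      - ∑ k ∈ Finset.range m, (-1) ^ (k + 1) * g (k + 1) * polygammaTerm m k c := by
  rw [polygammaExpansion, show 2 * (m + 1) - 1 = 2 * m + 1 by omega,
    show 2 * (m + 1) - 2 = 2 * m by omega, Nat.add_sub_cancel]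
  congr 1
  · rw [div_eq_mul_inv, one_div, mul_assoc]
  · rw [← Finset.Ico_add_one_right_eq_Icc, Finset.sum_Ico_eq_sum_range, Nat.add_sub_cancel]
    refine Finset.sum_congr rfl fun k _ => ?_
    rw [polygammaTerm, show 2 * (m + 1) - (1 + k) - 2 = 2 * m - k - 1 by omega, add_comm 1 k]
    push_cast
    rw [one_div, ← mul_assoc]

theorem hasDerivAt_inv_pow (p : ℕ) {c : ℝ} (hc : 0 < c) :
    HasDerivAt (fun c : ℝ => (c ^ p)⁻¹) (-p * (c ^ (p + 1))⁻¹) c := by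
  convert! (hasDerivAt_pow p c).fun_inv (by positivity) using 1
  rcases p with _ | p
  · simp
  · simp only [Nat.add_sub_cancel]
    field_simp
    ring

/-- Product rule, with a factor `c` extracted so that both pieces are terms of level `m + 1`. The
`1/2` comes from the inner derivative `1 / 2π`; divided by `-2(m + 1)c` and combined with the
alternating sign it becomes the `1 / (4(j - 1))` of the recursion at `j = m + 2`. -/
theorem hasDerivAt_polygammaTerm {m k : ℕ} (hk : k < m) {c : ℝ} (hc : 0 < c) :
    HasDerivAt (polygammaTerm m k) (-(2 * m - k - 1) * c * polygammaTerm (m + 1) k c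
      + c / 2 * polygammaTerm (m + 1) (k + 1) c) c := by
  obtain ⟨p, hp⟩ : ∃ p, 2 * m = p + k + 1 := ⟨2 * m - k - 1, by omega⟩
  have hpi := Real.pi_pos
  have h1 : HasDerivAt (fun c : ℝ => realPolygamma (k + 1) (c / (2 * Real.pi)))
      (realPolygamma (k + 2) (c / (2 * Real.pi)) * (1 / (2 * Real.pi))) c :=
    HasDerivAt.comp (h₂ := realPolygamma (k + 1)) (h := fun c => c / (2 * Real.pi)) c
      (hasDerivAt_realPolygamma (k + 1) (by positivity)) ((hasDerivAt_id c).div_const _)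
  have h2 := ((hasDerivAt_inv_pow p hc).mul_const ((Real.pi ^ (k + 1))⁻¹)).fun_mul h1
  have e : polygammaTerm m k = fun c : ℝ =>
      (c ^ p)⁻¹ * (Real.pi ^ (k + 1))⁻¹ * realPolygamma (k + 1) (c / (2 * Real.pi)) := by
    ext c
    rw [polygammaTerm, show 2 * m - k - 1 = p by omega, mul_inv]
  rw [e]
  convert! h2 using 1
  have hp' : (2 * m - k - 1 : ℝ) = p := by
    have : (2 * m : ℝ) = p + k + 1 := by exact_mod_cast hp
    linarith
  rw [polygammaTerm, polygammaTerm, show 2 * (m + 1) - k - 1 = p + 2 by omega,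
    show 2 * (m + 1) - (k + 1) - 1 = p + 1 by omega, hp']
  field_simp
  ring

/-- Merges the cases `i = 1`, `2 ≤ i < j - 1` and `i = j - 1`: each switch tells whether the
corresponding predecessor is a polygamma coefficient of the previous row. -/
theorem GammaMinusRecursion.succ {γ : ℕ → ℤ → ℝ} (h : GammaMinusRecursion γ) {m k : ℕ}
    (hm : 1 ≤ m) (hk : k ≤ m) :
    γ (m + 2) (k + 1) = (if k < m then (2 * m - k - 1) / (2 * (m + 1)) * γ (m + 1) (k + 1) else 0)
      + (if 1 ≤ k then 1 / (4 * (m + 1)) * γ (m + 1) k else 0) := by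
  rcases Nat.eq_zero_or_pos k with rfl | hk0
  · have h1 := h.step_one (m + 2) (by omega)
    rw [show m + 2 - 1 = m + 1 by omega] at h1
    rw [if_pos (by omega), if_neg (by omega)]
    push_cast at h1 ⊢
    rw [h1]
    ring
  · rw [if_pos (show 1 ≤ k from hk0)]
    rcases hk.lt_or_eq with hlt | rfl
    · have h1 := h.step_mid (m + 2) (k + 1) (by omega) (by omega) (by push_cast; omega)
      rw [show m + 2 - 1 = m + 1 by omega, add_sub_cancel_right] at h1
      rw [if_pos hlt, h1]
      push_cast
      ring
    · have h1 := h.step_last (k + 2) (k + 1) (by omega) (by push_cast; omega)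
      rw [show k + 2 - 1 = k + 1 by omega, add_sub_cancel_right] at h1
      rw [if_neg (lt_irrefl k), h1]
      push_cast
      ring

theorem GammaMinusRecursion.hasDerivAt_polygammaExpansion {γ : ℕ → ℤ → ℝ}
    (h : GammaMinusRecursion γ) {m : ℕ} (hm : 1 ≤ m) {c : ℝ} (hc : 0 < c) :
    HasDerivAt (polygammaExpansion (m + 1) (γ (m + 1)))
      (-2 * (m + 1) * c * polygammaExpansion (m + 2) (γ (m + 2)) c) c := by
  have e : polygammaExpansion (m + 1) (γ (m + 1)) = fun c =>
      - γ (m + 1) (-1) * Real.pi * (c ^ (2 * m + 1))⁻¹ - γ (m + 1) 0 * (c ^ (2 * m))⁻¹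
      - ∑ k ∈ Finset.range m, (-1) ^ (k + 1) * γ (m + 1) (k + 1) * polygammaTerm m k c := by
    ext c
    exact polygammaExpansion_succ m _ c
  rw [e]
  convert! (((hasDerivAt_inv_pow (2 * m + 1) hc).const_mul (-γ (m + 1) (-1) * Real.pi)).fun_sub
    ((hasDerivAt_inv_pow (2 * m) hc).const_mul (γ (m + 1) 0))).fun_sub
    (HasDerivAt.fun_sum fun k hk => (hasDerivAt_polygammaTerm (Finset.mem_range.1 hk) hc).const_mul
      ((-1) ^ (k + 1) * γ (m + 1) (k + 1))) using 1
  have h1 := h.step_neg_one (m + 2) (by omega)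
  have h0 := h.step_zero (m + 2) (by omega)
  rw [show m + 2 - 1 = m + 1 by omega] at h1 h0
  rw [show (2 * ((m + 2 : ℕ) : ℝ) - 2) = 2 * (m + 1) by push_cast; ring] at h1
  rw [show (((m + 2 : ℕ) : ℝ) - 1) = m + 1 by push_cast; ring] at h0
  rw [polygammaExpansion_succ (m + 1), h1, h0, mul_sub, mul_sub]
  congr 1
  · congr 1 <;> (push_cast; field_simp; ring)
  · rw [Finset.mul_sum]
    have hs : ∀ k ∈ Finset.range (m + 1), -2 * (m + 1) * c *
        ((-1) ^ (k + 1) * γ (m + 2) (k + 1) * polygammaTerm (m + 1) k c)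
        = -2 * (m + 1) * c * (-1) ^ (k + 1) * polygammaTerm (m + 1) k c *
            (if k < m then (2 * m - k - 1) / (2 * (m + 1)) * γ (m + 1) (k + 1) else 0)
          + -2 * (m + 1) * c * (-1) ^ (k + 1) * polygammaTerm (m + 1) k c *
            (if 1 ≤ k then 1 / (4 * (m + 1)) * γ (m + 1) k else 0) := fun k hk => by
      rw [h.succ hm (Nat.lt_succ_iff.1 (Finset.mem_range.1 hk))]
      ring
    -- The switches kill the last term of the first sum and the initial term of the second; after
    -- shifting the second index both sums run over `k < m`.
    rw [Finset.sum_congr rfl hs, Finset.sum_add_distrib, Finset.sum_range_succ,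
      Finset.sum_range_succ' (n := m), if_neg (lt_irrefl m), if_neg (by omega), mul_zero, mul_zero,
      add_zero, add_zero, ← Finset.sum_add_distrib]
    refine Finset.sum_congr rfl fun k hk => ?_
    rw [if_pos (Finset.mem_range.1 hk), if_pos (by omega)]
    push_cast
    field_simp
    ring

theorem GammaMinusRecursion.normIntegralMinus_eq {γ : ℕ → ℤ → ℝ} (h : GammaMinusRecursion γ)
    {j : ℕ} (hj : 2 ≤ j) :
    ∀ c : ℝ, 0 < c → normIntegralMinus 1 j 1 c = polygammaExpansion j (γ j) c := by
  induction j, hj using Nat.le_induction with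
  | base =>
    intro c hc
    rw [normIntegralMinus_two hc, polygammaExpansion_succ 1, h.start_neg_one, h.start_zero]
    simp only [Finset.sum_range_one, polygammaTerm, Nat.cast_zero, zero_add, h.start_one]
    norm_num
    ring
  | succ j hj ih =>
    intro c hc
    obtain ⟨m, rfl⟩ := Nat.exists_eq_add_of_le' (show 1 ≤ j by omega)
    have h1 := hasDerivAt_normIntegralMinus (j := m + 1) (by omega) hc
    have h2 := h.hasDerivAt_polygammaExpansion (show 1 ≤ m by omega) hc
    -- The induction hypothesis holds near `c`, so both sides have the same derivative; then cancel
    -- `-2(m + 1)c`.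
    have h3 := h1.unique (h2.congr_of_eventuallyEq (by
      filter_upwards [lt_mem_nhds hc] with b hb
      exact ih b hb))
    refine mul_left_cancel₀ (a := -2 * ((m : ℝ) + 1) * c) ?_ (by simpa using h3)
    exact mul_ne_zero (mul_ne_zero (by norm_num) (by positivity)) hc.ne'

/-! ### Uniqueness of the coefficients -/

/-- At `c = 2πx`, multiplication by `c ^ (2m + 1)` turns the difference of the expansions into a
relation among `1`, `x` and `x ^ (k + 2) ψ^{(k + 1)}(x)`. -/
theorem polygammaExpansion_injective {m : ℕ} {g h : ℤ → ℝ}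
    (hgh : ∀ c : ℝ, 0 < c → polygammaExpansion (m + 1) g c = polygammaExpansion (m + 1) h c) :
    g (-1) = h (-1) ∧ g 0 = h 0 ∧ ∀ k < m, g (k + 1) = h (k + 1) := by
  have hpi := Real.pi_pos
  obtain ⟨hA, hB, ha⟩ := eq_zero_of_digamma_relation m (((g (-1) - h (-1)) * Real.pi : ℝ) : ℂ)
    (((g 0 - h 0) * (2 * Real.pi) : ℝ) : ℂ)
    (fun k => (((-1) ^ (k + 1) * (g (k + 1) - h (k + 1)) * (2 ^ (k + 2) * Real.pi) : ℝ) : ℂ))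
    (fun x hx => by
      simp_rw [← ofReal_realPolygamma]
      have h1 := hgh (2 * Real.pi * x) (by positivity)
      rw [polygammaExpansion_succ, polygammaExpansion_succ] at h1
      have hk : ∀ k ∈ Finset.range m, ∀ d : ℝ, (2 * Real.pi * x) ^ (2 * m + 1) *
          ((-1) ^ (k + 1) * d * polygammaTerm m k (2 * Real.pi * x)) =
          (-1) ^ (k + 1) * d * (2 ^ (k + 2) * Real.pi) *
            (x ^ (k + 2) * realPolygamma (k + 1) x) := fun k hk d => by
        obtain ⟨p, hp⟩ : ∃ p, 2 * m = p + k + 1 :=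
          ⟨2 * m - k - 1, by have := Finset.mem_range.1 hk; omega⟩
        rw [polygammaTerm, show 2 * m - k - 1 = p by omega, hp,
          show 2 * Real.pi * x / (2 * Real.pi) = x by field_simp]
        field_simp
        ring
      have h2 := congrArg (fun t => (2 * Real.pi * x) ^ (2 * m + 1) * t) h1
      simp only [mul_sub, Finset.mul_sum] at h2
      rw [Finset.sum_congr rfl fun k hk' => hk k hk' (g (k + 1)),
        Finset.sum_congr rfl fun k hk' => hk k hk' (h (k + 1))] at h2
      have h3 : (g (-1) - h (-1)) * Real.pi + (g 0 - h 0) * (2 * Real.pi) * x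
          + ∑ k ∈ Finset.range m, (-1) ^ (k + 1) * (g (k + 1) - h (k + 1)) *
            (2 ^ (k + 2) * Real.pi) * (x ^ (k + 2) * realPolygamma (k + 1) x) = 0 := by
        simp only [mul_sub, sub_mul, Finset.sum_sub_distrib]
        have e1 : ∀ d : ℝ, (2 * Real.pi * x) ^ (2 * m + 1) *
            (d * Real.pi * ((2 * Real.pi * x) ^ (2 * m + 1))⁻¹) = d * Real.pi := fun d => by
          field_simp
        have e2 : ∀ d : ℝ, (2 * Real.pi * x) ^ (2 * m + 1) *
            (d * ((2 * Real.pi * x) ^ (2 * m))⁻¹) = d * (2 * Real.pi * x) := fun d => by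
          rw [pow_succ]
          field_simp
        rw [e1, e1, e2, e2] at h2
        linear_combination -h2
      exact_mod_cast h3)
  refine ⟨?_, ?_, fun k hk => ?_⟩
  · have := Complex.ofReal_eq_zero.1 hA
    exact sub_eq_zero.1 ((mul_eq_zero.1 this).resolve_right hpi.ne')
  · have := Complex.ofReal_eq_zero.1 hB
    exact sub_eq_zero.1 ((mul_eq_zero.1 this).resolve_right (by positivity))
  · have := Complex.ofReal_eq_zero.1 (ha k hk)
    have := (mul_eq_zero.1 this).resolve_right (by positivity)
    exact sub_eq_zero.1 ((mul_eq_zero.1 this).resolve_left (pow_ne_zero _ (by norm_num)))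

/-! ### Existence of the array and the equivalence -/

/-- The solution of the recursion `GammaMinusRecursion`. -/
noncomputable def gammaMinusArray : ℕ → ℤ → ℝ
  | 0 => 0
  | 1 => 0
  -- Only `-1 ≤ i ≤ 1` matters in this row; entries outside the triangle are arbitrary throughout.
  | 2 => fun i => if i = 1 then 1 / 8 else 1 / 4
  | j + 3 => fun i =>
    if i = -1 then (2 * ((j + 3 : ℕ) : ℝ) - 3) / (2 * ((j + 3 : ℕ) : ℝ) - 2)
      * gammaMinusArray (j + 2) i
    else if i = 0 then (((j + 3 : ℕ) : ℝ) - 2) / (((j + 3 : ℕ) : ℝ) - 1)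
      * gammaMinusArray (j + 2) i
    else if i = 1 then (2 * ((j + 3 : ℕ) : ℝ) - 1 - 4) / (2 * ((j + 3 : ℕ) : ℝ) - 2)
      * gammaMinusArray (j + 2) i
    else if i < j + 2 then (2 * ((j + 3 : ℕ) : ℝ) - (i : ℝ) - 4) / (2 * ((j + 3 : ℕ) : ℝ) - 2)
        * gammaMinusArray (j + 2) i
      + 1 / (4 * (((j + 3 : ℕ) : ℝ) - 1)) * gammaMinusArray (j + 2) (i - 1)
    else 1 / (4 * (((j + 3 : ℕ) : ℝ) - 1)) * gammaMinusArray (j + 2) (i - 1)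

theorem gammaMinusRecursion_gammaMinusArray : GammaMinusRecursion gammaMinusArray where
  start_neg_one := by simp [gammaMinusArray]
  start_zero := by simp [gammaMinusArray]
  start_one := by simp [gammaMinusArray]
  step_neg_one j hj := by
    obtain ⟨k, rfl⟩ := Nat.exists_eq_add_of_le' (show 3 ≤ j from hj)
    rw [gammaMinusArray]
    beta_reduce
    rw [if_pos rfl, show k + 3 - 1 = k + 2 by omega]
  step_zero j hj := by
    obtain ⟨k, rfl⟩ := Nat.exists_eq_add_of_le' (show 3 ≤ j from hj)
    rw [gammaMinusArray]
    beta_reduce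
    rw [if_neg (by omega), if_pos rfl, show k + 3 - 1 = k + 2 by omega]
  step_one j hj := by
    obtain ⟨k, rfl⟩ := Nat.exists_eq_add_of_le' (show 3 ≤ j from hj)
    rw [gammaMinusArray]
    beta_reduce
    rw [if_neg (by omega), if_neg (by omega), if_pos rfl,
      show k + 3 - 1 = k + 2 by omega]
  step_mid j i hj hi hij := by
    obtain ⟨k, rfl⟩ := Nat.exists_eq_add_of_le' (show 3 ≤ j from hj)
    rw [gammaMinusArray]
    beta_reduce
    rw [if_neg (by omega), if_neg (by omega), if_neg (by omega),
      if_pos (by omega), show k + 3 - 1 = k + 2 by omega]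
  step_last j i hj hi := by
    obtain ⟨k, rfl⟩ := Nat.exists_eq_add_of_le' (show 3 ≤ j from hj)
    rw [gammaMinusArray]
    beta_reduce
    rw [if_neg (by omega), if_neg (by omega), if_neg (by omega),
      if_neg (by omega), show k + 3 - 1 = k + 2 by omega]

/-- The recursion never reads an entry outside `-1 ≤ i ≤ j - 1`, and an expansion determines no
others. -/
theorem GammaMinusRecursion.congr {γ δ : ℕ → ℤ → ℝ} (h : GammaMinusRecursion δ)
    (hγ : ∀ (j : ℕ) (i : ℤ), 2 ≤ j → -1 ≤ i → i ≤ (j : ℤ) - 1 → γ j i = δ j i) :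
    GammaMinusRecursion γ where
  start_neg_one := by rw [hγ 2 _ le_rfl (by omega) (by omega), h.start_neg_one]
  start_zero := by rw [hγ 2 _ le_rfl (by omega) (by omega), h.start_zero]
  start_one := by rw [hγ 2 _ le_rfl (by omega) (by omega), h.start_one]
  step_neg_one j hj := by
    rw [hγ j _ (by omega) (by omega) (by omega), hγ (j - 1) _ (by omega) (by omega) (by omega),
      h.step_neg_one j hj]
  step_zero j hj := by
    rw [hγ j _ (by omega) (by omega) (by omega), hγ (j - 1) _ (by omega) (by omega) (by omega),
      h.step_zero j hj]
  step_one j hj := by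
    rw [hγ j _ (by omega) (by omega) (by omega), hγ (j - 1) _ (by omega) (by omega) (by omega),
      h.step_one j hj]
  step_mid j i hj hi hij := by
    rw [hγ j _ (by omega) (by omega) (by omega), hγ (j - 1) i (by omega) (by omega) (by omega),
      hγ (j - 1) (i - 1) (by omega) (by omega) (by omega), h.step_mid j i hj hi hij]
  step_last j i hj hi := by
    rw [hγ j _ (by omega) (by omega) (by omega),
      hγ (j - 1) (i - 1) (by omega) (by omega) (by omega), h.step_last j i hj hi]

theorem mainTheorem1 :
    -- the integrals converge
    (∀ j : ℕ, 2 ≤ j → ∀ b μ : ℝ, 0 < b → 0 < μ →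
      IntegrableOn (integrandMinus 1 j 1 b μ) (Ioi 0)) ∧
    -- the recursion has a solution
    (∃ γ : ℕ → ℤ → ℝ, GammaMinusRecursion γ) ∧
    -- recursively constructed coefficients are expansion coefficients
    (∀ γ : ℕ → ℤ → ℝ, GammaMinusRecursion γ →
      ∀ j : ℕ, 2 ≤ j → ∀ b μ : ℝ, 0 < b → 0 < μ →
        normIntegralMinus 1 j 1 (b * μ) = polygammaExpansion j (γ j) (b * μ) ∧
        integralMinus 1 j 1 b μ = μ ^ (2 * j - 2) * polygammaExpansion j (γ j) (b * μ)) ∧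
    -- expansion coefficients obey the recursion
    (∀ γ : ℕ → ℤ → ℝ,
      (∀ j : ℕ, 2 ≤ j → ∀ b μ : ℝ, 0 < b → 0 < μ →
        normIntegralMinus 1 j 1 (b * μ) = polygammaExpansion j (γ j) (b * μ)) →
      GammaMinusRecursion γ) := by
  refine ⟨fun j hj b μ hb hμ => integrableOn_integrandMinus (by omega) hb hμ,
    ⟨_, gammaMinusRecursion_gammaMinusArray⟩, fun γ hγ j hj b μ hb hμ => ?_, fun γ hγ => ?_⟩
  · have h := hγ.normIntegralMinus_eq hj (b * μ) (mul_pos hb hμ)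
    exact ⟨h, by rw [integralMinus_scale j (by omega) hμ, h]⟩
  -- The constructed array expands the same integrals, so uniqueness identifies `γ` with it on the
  -- triangle; `μ = 1` already supplies every `c > 0`.
  · refine gammaMinusRecursion_gammaMinusArray.congr fun j i hj hi hij => ?_
    obtain ⟨m, rfl⟩ := Nat.exists_eq_add_of_le' (show 1 ≤ j by omega)
    obtain ⟨h1, h0, hk⟩ := polygammaExpansion_injective (m := m) (g := γ (m + 1))
      (h := gammaMinusArray (m + 1)) fun c hc => by
        have h := hγ (m + 1) hj c 1 hc one_pos
        rw [mul_one] at h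
        rw [← h, gammaMinusRecursion_gammaMinusArray.normIntegralMinus_eq hj c hc]
    rcases (show i = -1 ∨ i = 0 ∨ 1 ≤ i by omega) with rfl | rfl | hi1
    · exact h1
    · exact h0
    · obtain ⟨k, rfl⟩ : ∃ k : ℕ, i = k + 1 := (Int.eq_ofNat_of_zero_le (show 0 ≤ i - 1 by omega)).imp
        fun k hk => by omega
      exact hk k (by omega)
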